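/- A frequency is a strictly increasing sequence $\omega=(\omega_n)_{n\in\mathbb N}$, $\mathbb N=\{1,2,\dots\}$, of non-negative reals with $\omega_n\to\infty$. For a finite set $J\subset\mathbb N$ let $\mathcal H_\infty^J(\omega)$ be the complex Banach space of all Dirichlet polynomials $D(s)=\sum_{n\in J}a_ne^{-\omega_ns}$ $(a_n\in\mathbb C,\ s\in\mathbb C)$ with norm $\|D\|_\infty=\sup_{t\in\mathbb R}|D(it)|$, and for $x\in\mathbb N$ put $\mathcal H_\infty^{\le x}(\omega)=\mathcal H_\infty^{\{1,\dots,x\}}(\omega)$. The projection constant of a complex Banach space $X$ is $\boldsymbol\lambda(X)=\sup\boldsymbol\lambda(I(X),Y)$, the supremum being over all complex Banach spaces $Y$ and all linear isometric embeddings $I\colon X\to Y$ with complemented range, where $\boldsymbol\lambda(Z,Y)=\inf\{\|P\|: P\in\mathcal L(Y,Z),\ P|_Z=\mathrm{id}_Z\}$. **Theorem.** Let $\omega$ be a $\mathbb Q$-linearly independent frequency. Then for every finite set $J\subset\mathbb N$ the map $$\mathcal H_\infty^J(\omega)\to\ell_1^{|J|}=\ell_1(J;\mathbb C),\qquad \sum_{n\in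 J}a_ne^{-\omega_ns}\mapsto(a_n)_{n\in J}$$ is a well-defined surjective linear isometry, and $$\boldsymbol\lambda\big(\mathcal H_\infty^J(\omega)\big)=\int_{\mathbb T^{|J|}}\Big|\sum_{k=1}^{|J|}z_k\Big|\,dz,$$ where $dz$ is the normalized Lebesgue measure on $\mathbb T^{|J|}$. Moreover, $$\lim_{x\to\infty}\frac{\boldsymbol\lambda\big(\mathcal H_\infty^{\le x}(\omega)\big)}{\sqrt x}=\frac{\sqrt\pi}{2}\qquad(x\in\mathbb N).$$ In particular, $\omega=(\log p_n)_{n\in\mathbb N}$, with $p_n$ the $n$th prime, is a $\mathbb Q$-linearly independent frequency, and the last limit formula holds for it. -/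

import Mathlib

universe u v

open scoped ENNReal

/-! ### Projection constants -/

/-- The relative projection constant of a subspace `X` of a complex normed space `Y`: the infimum of
the norms of all bounded linear projections of `Y` onto `X`; it is `∞` if there is none. -/
noncomputable def relativeProjectionConstant {Y : Type v} [NormedAddCommGroup Y] [NormedSpace ℂ Y]
    (X : Submodule ℂ Y) : ℝ≥0∞ :=
  ⨅ (P : Y →L[ℂ] X) (_ : ∀ x : X, P x = x), ‖P‖ₑ

/-- The (absolute) projection constant of a complex Banach space `X`: the supremum of the relative
projection constants of `I(X)` in `Y`, over all complex Banach spaces `Y` (in the universe `v`) and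
all linear isometric embeddings `I : X → Y` with complemented range. -/
noncomputable def projectionConstant (X : Type u) [NormedAddCommGroup X] [NormedSpace ℂ X] : ℝ≥0∞ :=
  sSup {r : ℝ≥0∞ | ∃ (Y : Type v) (_ : NormedAddCommGroup Y) (_ : NormedSpace ℂ Y)
    (_ : CompleteSpace Y) (I : X →ₗᵢ[ℂ] Y), (LinearMap.range I.toLinearMap).ClosedComplemented ∧
      r = relativeProjectionConstant (LinearMap.range I.toLinearMap)}

/-! ### Frequencies and the Banach spaces of Dirichlet polynomials -/

/-- A frequency: a strictly increasing sequence `ω₁ < ω₂ < …` of non-negative reals tending to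
infinity. -/
structure IsFrequency (ω : ℕ+ → ℝ) : Prop where
  strictMono : StrictMono ω
  nonneg : ∀ n, 0 ≤ ω n
  tendsto_atTop : Filter.Tendsto ω Filter.atTop Filter.atTop

/-- The frequency `(log pₙ)`, where `p₁ = 2, p₂ = 3, …` enumerates the primes
(`Nat.nth Nat.Prime` starts at index `0`, and `n.natPred = n - 1`). -/
noncomputable def logPrimeFrequency (n : ℕ+) : ℝ :=
  Real.log (Nat.nth Nat.Prime n.natPred)

/-- The linear space of all `ω`-Dirichlet polynomials `D(s) = ∑_{n ∈ J} aₙ e^{-ωₙ s}`, `s ∈ ℂ`,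
supported on `J`. -/
noncomputable def dirichletPolynomials (ω : ℕ+ → ℝ) (J : Finset ℕ+) : Submodule ℂ (ℂ → ℂ) :=
  Submodule.span ℂ ((fun (n : ℕ+) (s : ℂ) => Complex.exp (-(ω n : ℂ) * s)) '' (J : Set ℕ+))

/-- The Banach space `H_∞^J(ω)`: the `ω`-Dirichlet polynomials supported on `J`, with the norm
`‖D‖ = sup_{t ∈ ℝ} |D(it)|` (see the instances below). -/
def DirichletSpace (ω : ℕ+ → ℝ) (J : Finset ℕ+) : Type := dirichletPolynomials ω J

namespace DirichletSpace

variable {ω : ℕ+ → ℝ} {J : Finset ℕ+}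

noncomputable instance : AddCommGroup (DirichletSpace ω J) :=
  inferInstanceAs (AddCommGroup (dirichletPolynomials ω J))

noncomputable instance : Module ℂ (DirichletSpace ω J) :=
  inferInstanceAs (Module ℂ (dirichletPolynomials ω J))

/-- The function `s ↦ D(s)` on `ℂ` given by a Dirichlet polynomial `D`. -/
def toFun (D : DirichletSpace ω J) : ℂ → ℂ := D.1

noncomputable instance : Norm (DirichletSpace ω J) :=
  ⟨fun D => ⨆ t : ℝ, ‖D.toFun (Complex.I * t)‖⟩

theorem norm_def (D : DirichletSpace ω J) : ‖D‖ = ⨆ t : ℝ, ‖D.toFun (Complex.I * t)‖ := rfl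

theorem toFun_add (D E : DirichletSpace ω J) (s : ℂ) :
    (D + E).toFun s = D.toFun s + E.toFun s := rfl

theorem toFun_smul (c : ℂ) (D : DirichletSpace ω J) (s : ℂ) :
    (c • D).toFun s = c * D.toFun s := rfl

theorem bddAbove (D : DirichletSpace ω J) :
    BddAbove (Set.range fun t : ℝ => ‖D.toFun (Complex.I * t)‖) := by
  obtain ⟨f, hf⟩ := D
  change BddAbove (Set.range fun t : ℝ => ‖f (Complex.I * t)‖)
  induction hf using Submodule.span_induction with
  | mem f h =>
    obtain ⟨n, -, rfl⟩ := h
    refine ⟨1, ?_⟩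
    rintro _ ⟨t, rfl⟩
    simp [Complex.norm_exp]
  | zero => exact ⟨0, by rintro _ ⟨t, rfl⟩; simp⟩
  | add f g _ _ hf hg =>
    obtain ⟨a, ha⟩ := hf
    obtain ⟨b, hb⟩ := hg
    refine ⟨a + b, ?_⟩
    rintro _ ⟨t, rfl⟩
    exact (norm_add_le _ _).trans (add_le_add (ha ⟨t, rfl⟩) (hb ⟨t, rfl⟩))
  | smul c f _ hf =>
    obtain ⟨a, ha⟩ := hf
    refine ⟨‖c‖ * a, ?_⟩
    rintro _ ⟨t, rfl⟩
    change ‖c * f _‖ ≤ _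
    rw [norm_mul]
    exact mul_le_mul_of_nonneg_left (ha ⟨t, rfl⟩) (norm_nonneg _)

theorem analytic (D : DirichletSpace ω J) : AnalyticOnNhd ℂ D.toFun Set.univ := by
  obtain ⟨f, hf⟩ := D
  change AnalyticOnNhd ℂ f Set.univ
  induction hf using Submodule.span_induction with
  | mem f h =>
    obtain ⟨n, -, rfl⟩ := h
    exact (analyticOnNhd_const.mul analyticOnNhd_id).cexp
  | zero => exact analyticOnNhd_const
  | add f g _ _ hf hg => exact hf.add hg
  | smul c f _ hf => exact (analyticOnNhd_const (v := c)).mul hf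

/-- A Dirichlet polynomial vanishing on the imaginary axis vanishes. -/
theorem eq_zero_of_forall (D : DirichletSpace ω J)
    (h : ∀ t : ℝ, D.toFun (Complex.I * t) = 0) : D = 0 := by
  apply Subtype.ext
  have hz : AnalyticOnNhd ℂ (fun _ : ℂ => (0 : ℂ)) Set.univ := analyticOnNhd_const
  refine AnalyticOnNhd.eq_of_frequently_eq (z₀ := 0) D.analytic hz ?_
  have h1 : Filter.Tendsto (fun t : ℝ => Complex.I * (t : ℂ)) (nhdsWithin 0 {0}ᶜ)
      (nhdsWithin 0 {0}ᶜ) := by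
    refine tendsto_nhdsWithin_iff.2 ⟨?_, ?_⟩
    · have : Continuous fun t : ℝ => Complex.I * (t : ℂ) := by fun_prop
      simpa using (this.tendsto 0).mono_left nhdsWithin_le_nhds
    · filter_upwards [self_mem_nhdsWithin] with t ht
      simpa using ht
  exact h1.frequently (Filter.Eventually.of_forall h).frequently

theorem normCore : NormedSpace.Core ℂ (DirichletSpace ω J) where
  norm_nonneg D := Real.iSup_nonneg fun _ => norm_nonneg _
  norm_smul c D := by
    simp only [norm_def, toFun_smul, norm_mul]
    exact (Real.mul_iSup_of_nonneg (norm_nonneg c) _).symm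
  norm_triangle D E := by
    refine ciSup_le fun t => ?_
    exact (norm_add_le _ _).trans (add_le_add (le_ciSup D.bddAbove t) (le_ciSup E.bddAbove t))
  norm_eq_zero_iff D := by
    constructor
    · intro h
      refine D.eq_zero_of_forall fun t => norm_le_zero_iff.1 ?_
      exact (le_ciSup D.bddAbove t).trans h.le
    · rintro rfl
      have : ∀ t : ℝ, (0 : DirichletSpace ω J).toFun (Complex.I * t) = 0 := fun _ => rfl
      simp [norm_def, this]

noncomputable instance : NormedAddCommGroup (DirichletSpace ω J) :=
  NormedAddCommGroup.ofCore normCore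

noncomputable instance : NormedSpace ℂ (DirichletSpace ω J) :=
  NormedSpace.ofCore normCore

end DirichletSpace

/-! ### Integration over the torus -/

/-- The integral `∫_{𝕋ⁿ} f(z) dz` with respect to the normalized Lebesgue (Haar) measure:
`(2π)⁻ⁿ ∫_{[0,2π]ⁿ} f(e^{it₁}, …, e^{itₙ}) dt`. -/
noncomputable def torusMean (n : ℕ) (f : (Fin n → ℂ) → ℝ) : ℝ :=
  ((2 * Real.pi) ^ n)⁻¹ *
    ∫ t in Set.Icc (0 : Fin n → ℝ) (fun _ => 2 * Real.pi),
      f (fun k => Complex.exp (Complex.I * (t k : ℂ)))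

open MeasureTheory Filter Topology ComplexConjugate

/-! ### Integration over the torus `UnitAddTorus d` -/

/-! For independent frequencies, Kronecker's theorem makes the orbit of `t ↦ (e^{iωₙt})` dense in
the torus. Hence the supremum over the imaginary axis is the supremum of `|∑ aₙ zₙ|` over the torus,
and this is `∑ |aₙ|`, because each `zₙ` can cancel the phase of `aₙ` (`iSup_norm_sum_exp`). What
remains concerns `ℓ₁ⁿ`, whose projection constant is `L = ∫ |∑ zₖ| dz`.

Upper bound: every `z` in the torus gives a functional `a ↦ ∑ aₖ zₖ` of norm at most one, which
Hahn–Banach extends to `Y`. The first-order Fourier coefficients in `z` of the extended functionals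
recover `a` on the copy of `ℓ₁ⁿ`, and duality bounds their `ℓ₁`-norm by `L`
(`exists_leftInverse_norm_le`). Lower bound: embed `ℓ₁ⁿ` as the linear functions in the continuous
functions on the torus, and test a left inverse on all translates of an approximate sign of `∑ zₖ`
(`torusL1_le_norm_leftInverse`).

Asymptotics: rotation invariance gives `∫ |Re ∑ zₖ| = (2/π) L`, so the one-dimensional central limit
theorem applies; bounded second moments upgrade weak convergence to convergence of first absolute
moments (`tendsto_torusL1_div_sqrt`). Independence of the `log pₙ` is unique factorization, read off
from p-adic norms. -/

instance UnitAddCircle.instIsProbabilityMeasureVolume :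
    IsProbabilityMeasure (volume : Measure UnitAddCircle) := ⟨UnitAddCircle.measure_univ⟩

theorem UnitAddCircle.integral_fourier (n : ℤ) :
    ∫ x : UnitAddCircle, fourier n x = if n = 0 then 1 else 0 := by
  rw [← UnitAddCircle.intervalIntegral_preimage 0]
  split_ifs with h
  · simp [h]
  · have hc : (2 * Real.pi * Complex.I * n : ℂ) ≠ 0 := by
      simp [h, Real.pi_ne_zero]
    simp only [fourier_coe_apply]
    have : ∀ x : ℝ, Complex.exp (2 * Real.pi * Complex.I * n * x / ((1 : ℝ) : ℂ)) =
        Complex.exp (2 * Real.pi * Complex.I * n * x) := fun x => by simp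
    simp only [this]
    rw [integral_exp_mul_complex hc]
    have h2 : Complex.exp (2 * Real.pi * Complex.I * n * ((0 + 1 : ℝ) : ℂ)) = 1 := by
      rw [Complex.exp_eq_one_iff]
      exact ⟨n, by push_cast; ring⟩
    rw [h2]
    simp

theorem UnitAddTorus.integral_mFourier {d : Type*} [Fintype d] (n : d → ℤ) :
    ∫ x : UnitAddTorus d, UnitAddTorus.mFourier n x = if n = 0 then 1 else 0 := by
  have : ∫ x : UnitAddTorus d, UnitAddTorus.mFourier n x =
      ∏ i, ∫ x : UnitAddCircle, fourier (n i) x :=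
    integral_fintype_prod_volume_eq_prod (fun i => (fourier (n i) : UnitAddCircle → ℂ))
  rw [this]
  simp only [UnitAddCircle.integral_fourier]
  split_ifs with h
  · simp [h]
  · obtain ⟨i, hi⟩ := Function.ne_iff.1 h
    exact Finset.prod_eq_zero (Finset.mem_univ i) (by simpa using hi)

/-! ### Kronecker's theorem -/

theorem tendsto_mean_exp (c : ℝ) :
    Tendsto (fun T : ℝ => (T⁻¹ : ℂ) * ∫ t in (0 : ℝ)..T, Complex.exp (Complex.I * c * t)) atTop
      (𝓝 (if c = 0 then 1 else 0)) := by
  split_ifs with h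
  · subst h
    refine tendsto_const_nhds.congr' ?_
    filter_upwards [eventually_gt_atTop 0] with T hT
    have : (T : ℂ) ≠ 0 := by exact_mod_cast hT.ne'
    simp [this]
  · have hc : Complex.I * c ≠ 0 := by simp [h]
    simp only [integral_exp_mul_complex hc]
    rw [tendsto_zero_iff_norm_tendsto_zero]
    have hlim : Tendsto (fun T : ℝ => T⁻¹ * (2 / |c|)) atTop (𝓝 0) := by
      simpa using tendsto_inv_atTop_zero.mul_const (2 / |c|)
    refine squeeze_zero' (Eventually.of_forall fun _ => norm_nonneg _) ?_ hlim
    filter_upwards [eventually_gt_atTop 0] with T hT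
    rw [norm_mul, norm_div]
    have h1 : ‖(T⁻¹ : ℂ)‖ = T⁻¹ := by simp [abs_of_pos hT]
    have h2 : ‖Complex.I * c‖ = |c| := by simp
    have hu : ∀ t : ℝ, ‖Complex.exp (Complex.I * c * t)‖ = 1 := fun t => by
      simp [Complex.norm_exp]
    rw [h1, h2]
    gcongr
    refine (norm_sub_le _ _).trans ?_
    rw [hu, hu]
    norm_num

/-- The orbit `t ↦ (ωᵢ t / 2π)ᵢ` in the torus. -/
noncomputable def torusOrbit {d : Type*} (ω : d → ℝ) (t : ℝ) : UnitAddTorus d :=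
  fun i => ((ω i * t / (2 * Real.pi) : ℝ) : UnitAddCircle)

theorem continuous_torusOrbit {d : Type*} (ω : d → ℝ) : Continuous (torusOrbit ω) := by
  refine continuous_pi fun i => ?_
  exact (AddCircle.continuous_mk' 1).comp (by fun_prop)

theorem mFourier_torusOrbit {d : Type*} [Fintype d] (ω : d → ℝ) (n : d → ℤ) (t : ℝ) :
    UnitAddTorus.mFourier n (torusOrbit ω t) =
      Complex.exp (Complex.I * (∑ i, n i * ω i : ℝ) * t) := by
  simp only [UnitAddTorus.mFourier, torusOrbit, ContinuousMap.coe_mk, fourier_coe_apply]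
  rw [← Complex.exp_sum]
  congr 1
  push_cast
  rw [Finset.mul_sum, Finset.sum_mul]
  refine Finset.sum_congr rfl fun i _ => ?_
  have : (Real.pi : ℂ) ≠ 0 := by exact_mod_cast Real.pi_ne_zero
  field_simp

/-- Weyl's equidistribution theorem for the linear flow with rationally independent slopes. -/
theorem tendsto_mean_torusOrbit {d : Type*} [Fintype d] {ω : d → ℝ} (hω : LinearIndependent ℤ ω)
    (h : C(UnitAddTorus d, ℂ)) :
    Tendsto (fun T : ℝ => (T⁻¹ : ℂ) * ∫ t in (0 : ℝ)..T, h (torusOrbit ω t)) atTop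
      (𝓝 (∫ x, h x)) := by
  have hint : ∀ (f : C(UnitAddTorus d, ℂ)) (a b : ℝ),
      IntervalIntegrable (fun t => f (torusOrbit ω t)) volume a b := fun f a b =>
    (f.continuous.comp (continuous_torusOrbit ω)).intervalIntegrable a b
  have hint' : ∀ f : C(UnitAddTorus d, ℂ), Integrable f := fun f =>
    f.continuous.integrable_of_hasCompactSupport (HasCompactSupport.of_compactSpace f)
  have hspan : ∀ f ∈ Submodule.span ℂ (Set.range (UnitAddTorus.mFourier (d := d))),
      Tendsto (fun T : ℝ => (T⁻¹ : ℂ) * ∫ t in (0 : ℝ)..T, f (torusOrbit ω t)) atTop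
      (𝓝 (∫ x, f x)) := by
    intro f hf
    induction hf using Submodule.span_induction with
    | mem f hf =>
      obtain ⟨n, rfl⟩ := hf
      rw [UnitAddTorus.integral_mFourier]
      simp only [mFourier_torusOrbit]
      have := tendsto_mean_exp (∑ i, n i * ω i)
      -- The only use of independence: a nontrivial character has nonzero speed along the orbit, so
      -- its time average vanishes in the limit.
      have hiff : (∑ i, n i * ω i = 0) ↔ n = 0 := by
        constructor
        · intro h0
          have := Fintype.linearIndependent_iff.1 hω n (by simpa using h0)
          exact funext this
        · rintro rfl
          simp
      simpa only [hiff] using this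
    | zero => simp
    | add f g _ _ hf hg =>
      simp only [ContinuousMap.add_apply]
      rw [integral_add (hint' f) (hint' g)]
      refine (hf.add hg).congr fun T => ?_
      rw [intervalIntegral.integral_add (hint f _ _) (hint g _ _), mul_add]
    | smul c f _ hf =>
      simp only [ContinuousMap.smul_apply, smul_eq_mul]
      rw [integral_const_mul]
      refine (hf.const_mul c).congr fun T => ?_
      rw [intervalIntegral.integral_const_mul]
      ring
  rw [Metric.tendsto_nhds]
  intro ε hε
  have hmem : h ∈ closure (Submodule.span ℂ (Set.range (UnitAddTorus.mFourier (d := d))) :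
      Set C(UnitAddTorus d, ℂ)) := by
    rw [← Submodule.topologicalClosure_coe, UnitAddTorus.span_mFourier_closure_eq_top]
    trivial
  obtain ⟨f, hf, hfh⟩ := Metric.mem_closure_iff.1 hmem (ε / 3) (by positivity)
  filter_upwards [(Metric.tendsto_nhds.1 (hspan f hf)) (ε / 3) (by positivity),
    eventually_gt_atTop 0] with T hT hT0
  have hpt : ∀ x, ‖h x - f x‖ ≤ ε / 3 := fun x => by
    rw [← dist_eq_norm]
    exact (ContinuousMap.dist_apply_le_dist x).trans hfh.le
  have h1 : dist ((T⁻¹ : ℂ) * ∫ t in (0 : ℝ)..T, h (torusOrbit ω t))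
      ((T⁻¹ : ℂ) * ∫ t in (0 : ℝ)..T, f (torusOrbit ω t)) ≤ ε / 3 := by
    rw [dist_eq_norm, ← mul_sub, ← intervalIntegral.integral_sub (hint h _ _) (hint f _ _),
      norm_mul]
    have hT' : ‖(T⁻¹ : ℂ)‖ = T⁻¹ := by simp [abs_of_pos hT0]
    rw [hT', inv_mul_le_iff₀ hT0]
    refine (intervalIntegral.norm_integral_le_of_norm_le_const fun t _ => hpt _).trans ?_
    rw [sub_zero, abs_of_pos hT0, mul_comm]
  have h2 : dist (∫ x, f x) (∫ x, h x) ≤ ε / 3 := by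
    rw [dist_comm, dist_eq_norm, ← integral_sub (hint' h) (hint' f)]
    simpa using norm_integral_le_of_norm_le_const (μ := volume) (Eventually.of_forall hpt)
  refine (dist_triangle4 _ _ _ _).trans_lt ((add_lt_add_of_lt_of_le (add_lt_add_of_le_of_lt h1 hT)
    h2).trans_eq ?_)
  ring

/-- Kronecker's theorem. -/
theorem denseRange_torusOrbit {d : Type*} [Fintype d] {ω : d → ℝ} (hω : LinearIndependent ℤ ω) :
    DenseRange (torusOrbit ω) := by
  by_contra hd
  obtain ⟨x, hx⟩ : ∃ x, x ∉ closure (Set.range (torusOrbit ω)) := by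
    simpa [DenseRange, Dense] using hd
  -- The distance to the orbit closure vanishes along the orbit, so equidistribution forces its
  -- integral to be zero, although it is nonnegative, continuous and positive at `x`.
  let g : C(UnitAddTorus d, ℝ) :=
    ⟨fun y => Metric.infDist y (closure (Set.range (torusOrbit ω))), by fun_prop⟩
  let h : C(UnitAddTorus d, ℂ) := ⟨fun y => (g y : ℂ), by fun_prop⟩
  have hzero : ∀ t, h (torusOrbit ω t) = 0 := fun t => by
    have : g (torusOrbit ω t) = 0 := Metric.infDist_zero_of_mem (subset_closure ⟨t, rfl⟩)
    change (g (torusOrbit ω t) : ℂ) = 0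
    rw [this, Complex.ofReal_zero]
  have hl := tendsto_mean_torusOrbit hω h
  simp only [hzero, intervalIntegral.integral_zero, mul_zero] at hl
  have h0 : ∫ y, h y = 0 := (tendsto_nhds_unique hl tendsto_const_nhds)
  have h1 : ∫ y, g y = 0 := by
    have : ∫ y, h y = ((∫ y, g y : ℝ) : ℂ) := integral_ofReal
    rw [this] at h0
    exact_mod_cast h0
  have hpos : 0 < ∫ y, g y := by
    refine g.continuous.integral_pos_of_hasCompactSupport_nonneg_nonzero
      (HasCompactSupport.of_compactSpace _) (fun _ => Metric.infDist_nonneg) (x := x) ?_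
    have hne : (closure (Set.range (torusOrbit ω))).Nonempty := ⟨_, subset_closure ⟨0, rfl⟩⟩
    exact ((isClosed_closure.notMem_iff_infDist_pos hne).1 hx).ne'
  exact hpos.ne' h1

theorem exists_toCircle_mul_eq_norm (a : ℂ) :
    ∃ x : UnitAddCircle, a * (AddCircle.toCircle x : ℂ) = ‖a‖ := by
  obtain ⟨y, hy⟩ := (AddCircle.homeomorphCircle (T := (1 : ℝ)) one_ne_zero).surjective
    (Circle.exp (-a.arg))
  refine ⟨y, ?_⟩
  rw [AddCircle.homeomorphCircle_apply] at hy
  rw [hy, Circle.coe_exp]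
  nth_rw 1 [← Complex.norm_mul_exp_arg_mul_I a]
  rw [mul_assoc, ← Complex.exp_add]
  simp

theorem toCircle_torusOrbit {d : Type*} (ω : d → ℝ) (t : ℝ) (i : d) :
    (AddCircle.toCircle (torusOrbit ω t i) : ℂ) = Complex.exp (Complex.I * (ω i) * t) := by
  rw [torusOrbit, AddCircle.toCircle_apply_mk, Circle.coe_exp]
  congr 1
  push_cast
  have : (Real.pi : ℂ) ≠ 0 := by exact_mod_cast Real.pi_ne_zero
  field_simp

/-- For rationally independent frequencies, the sup norm of an almost periodic polynomial is the
`ℓ₁`-norm of its coefficients. -/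
theorem iSup_norm_sum_exp {d : Type*} [Fintype d] {ω : d → ℝ} (hω : LinearIndependent ℚ ω)
    (a : d → ℂ) :
    ⨆ t : ℝ, ‖∑ i, a i * Complex.exp (-(ω i : ℂ) * (Complex.I * t))‖ = ∑ i, ‖a i‖ := by
  have hle : ∀ t : ℝ, ‖∑ i, a i * Complex.exp (-(ω i : ℂ) * (Complex.I * t))‖ ≤ ∑ i, ‖a i‖ := by
    intro t
    refine (norm_sum_le _ _).trans (Finset.sum_le_sum fun i _ => ?_)
    simp [Complex.norm_exp]
  refine le_antisymm (ciSup_le hle) ?_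
  set M := ⨆ t : ℝ, ‖∑ i, a i * Complex.exp (-(ω i : ℂ) * (Complex.I * t))‖ with hM
  have hcl : IsClosed {x : UnitAddTorus d | ‖∑ i, a i * (AddCircle.toCircle (x i) : ℂ)‖ ≤ M} := by
    refine isClosed_le (Continuous.norm ?_) continuous_const
    refine continuous_finsetSum _ fun i _ => continuous_const.mul ?_
    exact continuous_subtype_val.comp (AddCircle.continuous_toCircle.comp (continuous_apply i))
  have hωZ : LinearIndependent ℤ ω := (LinearIndependent.iff_fractionRing ℤ ℚ).2 hω
  have hall : ∀ x : UnitAddTorus d, ‖∑ i, a i * (AddCircle.toCircle (x i) : ℂ)‖ ≤ M := by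
    intro x
    refine (denseRange_torusOrbit hωZ).induction_on (p := fun x =>
      ‖∑ i, a i * (AddCircle.toCircle (x i) : ℂ)‖ ≤ M) x hcl fun t => ?_
    -- Dirichlet polynomials carry `e^{-iωt}` while the orbit carries `e^{iωt}`, hence the time
    -- `-t`.
    refine le_trans (le_of_eq ?_) (le_ciSup ⟨_, Set.forall_mem_range.2 hle⟩ (-t))
    simp only [toCircle_torusOrbit]
    congr! 4
    push_cast
    ring
  choose x hx using fun i => exists_toCircle_mul_eq_norm (a i)
  have := hall x
  simp only [hx] at this
  rw [← Complex.ofReal_sum, Complex.norm_real, Real.norm_eq_abs] at this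
  exact (le_abs_self _).trans this

/-! ### `ℓ₁` coefficients of Dirichlet polynomials -/

namespace DirichletSpace

variable {ω : ℕ+ → ℝ} {J : Finset ℕ+}

/-- The Dirichlet polynomial with coefficients `a`. -/
noncomputable def ofCoeff (ω : ℕ+ → ℝ) (J : Finset ℕ+) :
    PiLp 1 (fun _ : J => ℂ) →ₗ[ℂ] DirichletSpace ω J where
  toFun a := (⟨∑ n : J, a n • fun s : ℂ => Complex.exp (-(ω n : ℂ) * s),
    Submodule.sum_mem _ fun n _ => Submodule.smul_mem _ _
      (Submodule.subset_span ⟨n, n.2, rfl⟩)⟩ : dirichletPolynomials ω J)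
  map_add' a b := by
    apply Subtype.ext
    change _ = (_ : ℂ → ℂ) + _
    simp [add_smul, Finset.sum_add_distrib]
  map_smul' c a := by
    apply Subtype.ext
    change _ = c • (_ : ℂ → ℂ)
    simp [mul_smul, Finset.smul_sum]

theorem ofCoeff_toFun (a : PiLp 1 (fun _ : J => ℂ)) (s : ℂ) :
    (ofCoeff ω J a).toFun s = ∑ n : J, a n * Complex.exp (-(ω n : ℂ) * s) := by
  change (∑ n : J, a n • fun s : ℂ => Complex.exp (-(ω n : ℂ) * s)) s = _
  simp

theorem ofCoeff_surjective : Function.Surjective (ofCoeff ω J) := by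
  rintro ⟨f, hf⟩
  suffices h : f ∈ (LinearMap.range (ofCoeff ω J)).map (dirichletPolynomials ω J).subtype by
    obtain ⟨_, ⟨a, rfl⟩, h⟩ := h
    exact ⟨a, Subtype.ext h⟩
  refine Submodule.span_le.2 ?_ hf
  rintro _ ⟨n, hn, rfl⟩
  refine ⟨_, ⟨PiLp.single 1 ⟨n, hn⟩ 1, rfl⟩, ?_⟩
  ext s
  refine (ofCoeff_toFun _ s).trans ?_
  rw [Finset.sum_eq_single ⟨n, hn⟩] <;> simp +contextual

theorem norm_ofCoeff (hω : LinearIndependent ℚ ω) (a : PiLp 1 (fun _ : J => ℂ)) :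
    ‖ofCoeff ω J a‖ = ‖a‖ := by
  rw [norm_def, PiLp.norm_eq_of_L1]
  simp only [ofCoeff_toFun]
  exact iSup_norm_sum_exp (hω.comp (fun n : J => (n : ℕ+)) Subtype.val_injective) _

/-- The isometric identification of `H_∞^J(ω)` with `ℓ₁(J)`. -/
noncomputable def coeffEquiv (hω : LinearIndependent ℚ ω) (J : Finset ℕ+) :
    DirichletSpace ω J ≃ₗᵢ[ℂ] PiLp 1 (fun _ : J => ℂ) :=
  (LinearIsometryEquiv.ofSurjective ⟨ofCoeff ω J, norm_ofCoeff hω⟩ ofCoeff_surjective).symm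

theorem coeffEquiv_symm_toFun (hω : LinearIndependent ℚ ω) (a : PiLp 1 (fun _ : J => ℂ)) (s : ℂ) :
    ((coeffEquiv hω J).symm a).toFun s = ∑ n : J, a n * Complex.exp (-(ω n : ℂ) * s) :=
  ofCoeff_toFun a s

end DirichletSpace

/-! ### The projection constant of `ℓ₁` -/

/-- The `L₁`-norm of `∑ zₖ` over the torus. -/
noncomputable def torusL1 (d : Type*) [Fintype d] : ℝ :=
  ∫ x : UnitAddTorus d, ‖∑ k, (AddCircle.toCircle (x k) : ℂ)‖

theorem torusL1_nonneg (d : Type*) [Fintype d] : 0 ≤ torusL1 d :=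
  integral_nonneg fun _ => norm_nonneg _

theorem continuous_coe_toCircle :
    Continuous fun x : UnitAddCircle => (AddCircle.toCircle x : ℂ) :=
  continuous_subtype_val.comp AddCircle.continuous_toCircle

@[simp]
theorem norm_coe_toCircle (x : UnitAddCircle) : ‖(AddCircle.toCircle x : ℂ)‖ = 1 :=
  Circle.norm_coe _

theorem torus_integrable {d E : Type*} [Fintype d] [NormedAddCommGroup E]
    {f : UnitAddTorus d → E} (hf : Continuous f) : Integrable f :=
  hf.integrable_of_hasCompactSupport (HasCompactSupport.of_compactSpace f)

theorem integral_coe_toCircle : ∫ x : UnitAddCircle, (AddCircle.toCircle x : ℂ) = 0 := by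
  have := UnitAddCircle.integral_fourier 1
  simpa only [fourier_one, one_ne_zero, if_false] using this

/-- The integrand is a product over coordinates, and for `j ≠ k` the `k`-th factor is a character of
mean zero. A general `f` is allowed so that the lemma also covers the discretized character of
`exists_simpleFunc_circle`. -/
theorem torus_integral_comp_mul_conj {d : Type*} [Fintype d] [DecidableEq d]
    (f : UnitAddCircle → ℂ) (j k : d) :
    ∫ x : UnitAddTorus d, f (x j) * conj (AddCircle.toCircle (x k) : ℂ) =
      if j = k then ∫ x, f x * conj (AddCircle.toCircle x : ℂ) else 0 := by
  have h1 : ∀ x : UnitAddTorus d, f (x j) * conj (AddCircle.toCircle (x k) : ℂ) =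
      ∏ i, (if i = j then f (x i) else 1) *
        (if i = k then conj (AddCircle.toCircle (x i) : ℂ) else 1) := by
    intro x
    rw [Finset.prod_mul_distrib]
    simp
  simp only [h1]
  rw [integral_fintype_prod_volume_eq_prod (fun i x => (if i = j then f x else 1) *
        (if i = k then conj (AddCircle.toCircle x : ℂ) else 1))]
  split_ifs with h
  · subst h
    rw [Finset.prod_eq_single j]
    · simp
    · intro i _ hi
      simp [hi]
    · simp
  · refine Finset.prod_eq_zero (Finset.mem_univ k) ?_
    have : ¬ k = j := fun h' => h h'.symm
    simp only [this, if_false, if_true, one_mul]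
    rw [integral_conj, integral_coe_toCircle, map_zero]

/-- Hahn–Banach extensions need not depend measurably on the torus point, so they are only sampled
at finitely many points. With `σ` close to the identity the integral is close to 1, and dividing by
it costs arbitrarily little in norm. -/
theorem exists_simpleFunc_circle {L C : ℝ} (h : L < C) :
    ∃ σ : SimpleFunc UnitAddCircle UnitAddCircle,
      (∫ x, (AddCircle.toCircle (σ x) : ℂ) * conj (AddCircle.toCircle x : ℂ)) ≠ 0 ∧
      L * ‖∫ x, (AddCircle.toCircle (σ x) : ℂ) * conj (AddCircle.toCircle x : ℂ)‖⁻¹ < C := by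
  let σ : ℕ → SimpleFunc UnitAddCircle UnitAddCircle := fun n =>
    SimpleFunc.approxOn id measurable_id Set.univ 0 trivial n
  have hlim : Tendsto (fun n => ∫ x, (AddCircle.toCircle (σ n x) : ℂ) *
      conj (AddCircle.toCircle x : ℂ)) atTop (𝓝 (∫ _ : UnitAddCircle, (1 : ℂ))) := by
    refine tendsto_integral_of_dominated_convergence (fun _ => 1) (fun n => ?_)
      (integrable_const _) (fun n => ?_) ?_
    · exact ((continuous_coe_toCircle.measurable.comp (σ n).measurable).mul
        (Complex.continuous_conj.comp continuous_coe_toCircle).measurable).aestronglyMeasurable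
    · exact Eventually.of_forall fun x => by simp
    · refine Eventually.of_forall fun x => ?_
      have h1 : Tendsto (fun n => σ n x) atTop (𝓝 x) :=
        SimpleFunc.tendsto_approxOn measurable_id (Set.mem_univ _) (by simp)
      have h2 := ((continuous_coe_toCircle.tendsto x).comp h1).mul_const
        (conj (AddCircle.toCircle x : ℂ))
      have h3 : (AddCircle.toCircle x : ℂ) * conj (AddCircle.toCircle x : ℂ) = 1 := by
        rw [Complex.mul_conj, Complex.normSq_eq_norm_sq]
        simp
      rwa [h3] at h2
  simp only [integral_const, probReal_univ, one_smul] at hlim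
  have hlim2 := ((hlim.norm.inv₀ (by simp)).const_mul L)
  simp only [norm_one, inv_one, mul_one] at hlim2
  obtain ⟨n, hn1, hn2⟩ := ((hlim.eventually_ne one_ne_zero).and (hlim2.eventually_lt_const h)).exists
  exact ⟨σ n, hn1, hn2⟩

theorem continuous_conj_toCircle_apply {d : Type*} (k : d) :
    Continuous fun z : UnitAddTorus d => conj (AddCircle.toCircle (z k) : ℂ) :=
  Complex.continuous_conj.comp (continuous_coe_toCircle.comp (continuous_apply k))

/-! ### Upper bound: a left inverse from Fourier coefficients of Hahn–Banach extensions -/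

section Upper

variable {d : Type*} [Fintype d] {Y : Type v} [NormedAddCommGroup Y] [NormedSpace ℂ Y]

theorem exists_extension_character (I : PiLp 1 (fun _ : d => ℂ) →ₗᵢ[ℂ] Y) (z : UnitAddTorus d) :
    ∃ g : Y →L[ℂ] ℂ, (∀ a, g (I a) = ∑ k, a k * (AddCircle.toCircle (z k) : ℂ)) ∧
      ∀ y, ‖g y‖ ≤ ‖y‖ := by
  let φ : PiLp 1 (fun _ : d => ℂ) →L[ℂ] ℂ := LinearMap.mkContinuous
    { toFun := fun a => ∑ k, a k * (AddCircle.toCircle (z k) : ℂ)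
      map_add' := fun a b => by simp [add_mul, Finset.sum_add_distrib]
      map_smul' := fun c a => by simp [Finset.mul_sum, mul_assoc] } 1 (fun a => by
        rw [one_mul, PiLp.norm_eq_of_L1]
        refine (norm_sum_le _ _).trans (le_of_eq ?_)
        simp)
  have hφ : ‖φ‖ ≤ 1 := LinearMap.mkContinuous_norm_le _ zero_le_one _
  obtain ⟨g, hg, hn⟩ := exists_extension_norm_eq (LinearMap.range I.toLinearMap)
    (φ.comp I.equivRange.symm.toContinuousLinearEquiv.toContinuousLinearMap)
  refine ⟨g, fun a => ?_, fun y => ?_⟩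
  · refine (hg (I.equivRange a)).trans ?_
    change φ (I.equivRange.symm (I.equivRange a)) = _
    rw [LinearIsometryEquiv.symm_apply_apply]
    rfl
  · refine (g.le_of_opNorm_le (c := 1) ?_ y).trans_eq (one_mul _)
    rw [hn]
    refine (ContinuousLinearMap.opNorm_comp_le _ _).trans ?_
    refine mul_le_one₀ hφ (norm_nonneg _) ?_
    exact I.equivRange.symm.toLinearIsometry.norm_toContinuousLinearMap_le

/-- After conjugation the integrand is a translate by `x` of the one defining `torusL1`, and Haar
measure is invariant. -/
theorem integral_norm_sum_mul_conj (x : UnitAddTorus d) :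
    ∫ z : UnitAddTorus d, ‖∑ k, (AddCircle.toCircle (x k) : ℂ) *
      conj (AddCircle.toCircle (z k) : ℂ)‖ = torusL1 d := by
  rw [torusL1, ← integral_sub_right_eq_self
    (fun z : UnitAddTorus d => ‖∑ k, (AddCircle.toCircle (z k) : ℂ)‖) x]
  refine integral_congr_ae (Eventually.of_forall fun z => ?_)
  dsimp only
  rw [← RCLike.norm_conj, map_sum]
  congr! 3 with k
  simp only [map_mul, Complex.conj_conj, Pi.sub_apply, sub_eq_add_neg, AddCircle.toCircle_add,
    AddCircle.toCircle_neg, Circle.coe_mul, Circle.coe_inv_eq_conj, mul_comm]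

theorem integrable_mul_conj_toCircle {F : UnitAddTorus d → ℂ} {M : ℝ}
    (hF : AEStronglyMeasurable F volume) (hM : ∀ z, ‖F z‖ ≤ M) (k : d) :
    Integrable fun z : UnitAddTorus d => F z * conj (AddCircle.toCircle (z k) : ℂ) := by
  refine Integrable.of_bound (hF.mul (continuous_conj_toCircle_apply k).aestronglyMeasurable) M
    (Eventually.of_forall fun z => ?_)
  simpa using hM z

/-- Duality of `ℓ₁` and `ℓ_∞`: unimodular phases merge the sum into one integral of `F` against `∑
xₖ z̄ₖ`, whose `L₁`-norm does not depend on the phases. -/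
theorem sum_norm_integral_mul_conj_le {F : UnitAddTorus d → ℂ} {M : ℝ}
    (hF : AEStronglyMeasurable F volume) (hM : ∀ z, ‖F z‖ ≤ M) :
    ∑ k, ‖∫ z : UnitAddTorus d, F z * conj (AddCircle.toCircle (z k) : ℂ)‖ ≤ M * torusL1 d := by
  choose x hx using fun k => exists_toCircle_mul_eq_norm
    (∫ z : UnitAddTorus d, F z * conj (AddCircle.toCircle (z k) : ℂ))
  have hint := integrable_mul_conj_toCircle hF hM
  have h1 : ((∑ k, ‖∫ z : UnitAddTorus d, F z * conj (AddCircle.toCircle (z k) : ℂ)‖ : ℝ) : ℂ) =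
      ∫ z : UnitAddTorus d, F z * ∑ k, (AddCircle.toCircle (x k) : ℂ) *
          conj (AddCircle.toCircle (z k) : ℂ) := by
    have h2 : ∀ z : UnitAddTorus d, F z * ∑ k, (AddCircle.toCircle (x k) : ℂ) *
          conj (AddCircle.toCircle (z k) : ℂ) = ∑ k, F z * conj (AddCircle.toCircle (z k) : ℂ) *
          (AddCircle.toCircle (x k) : ℂ) := fun z => by
      rw [Finset.mul_sum]
      exact Finset.sum_congr rfl fun k _ => by ring
    simp only [h2]
    rw [integral_finsetSum _ fun k _ => (hint k).mul_const _, Complex.ofReal_sum]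
    exact Finset.sum_congr rfl fun k _ => by rw [integral_mul_const, hx]
  have h3 : Integrable fun z : UnitAddTorus d => M * ‖∑ k, (AddCircle.toCircle (x k) : ℂ) *
      conj (AddCircle.toCircle (z k) : ℂ)‖ :=
    torus_integrable (continuous_const.mul (Continuous.norm
      (continuous_finsetSum _ fun k _ => continuous_const.mul (continuous_conj_toCircle_apply k))))
  have h4 := norm_integral_le_of_norm_le (f := fun z : UnitAddTorus d => F z *
    ∑ k, (AddCircle.toCircle (x k) : ℂ) * conj (AddCircle.toCircle (z k) : ℂ)) h3
    (Eventually.of_forall fun z => by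
      rw [norm_mul]
      exact mul_le_mul_of_nonneg_right (hM z) (norm_nonneg _))
  rw [← h1, integral_const_mul, integral_norm_sum_mul_conj, Complex.norm_real] at h4
  exact (le_abs_self _).trans h4

theorem exists_leftInverse_norm_le (I : PiLp 1 (fun _ : d => ℂ) →ₗᵢ[ℂ] Y) {C : ℝ}
    (hC : torusL1 d < C) :
    ∃ q : Y →L[ℂ] PiLp 1 (fun _ : d => ℂ), (∀ a, q (I a) = a) ∧ ‖q‖ ≤ C := by
  classical
  obtain ⟨σ, hc, hσ⟩ := exists_simpleFunc_circle hC
  set c := ∫ x, (AddCircle.toCircle (σ x) : ℂ) * conj (AddCircle.toCircle x : ℂ) with hcdef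
  choose g hgI hg using exists_extension_character I
  -- Discretizes every coordinate by `σ`. Since `τ` has finite range, `z ↦ g (τ z) y` is measurable
  -- whatever extensions were chosen.
  let τ : SimpleFunc (UnitAddTorus d) (UnitAddTorus d) :=
    { toFun := fun z k => σ (z k)
      measurableSet_fiber' := fun x => by
        have : Measurable fun (z : UnitAddTorus d) (k : d) => σ (z k) :=
          measurable_pi_lambda _ fun k => σ.measurable.comp (measurable_pi_apply k)
        exact this (measurableSet_singleton x)
      finite_range' := by
        refine (Set.Finite.pi' fun _ : d => σ.finite_range).subset ?_
        rintro _ ⟨z, rfl⟩ k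
        exact ⟨z k, rfl⟩ }
  have hmeas : ∀ y, AEStronglyMeasurable (fun z => g (τ z) y) volume := fun y =>
    (τ.map fun x => g x y).aestronglyMeasurable
  have hint := fun y => integrable_mul_conj_toCircle (hmeas y) (fun z => hg (τ z) y)
  let q₀ : Y →ₗ[ℂ] PiLp 1 (fun _ : d => ℂ) :=
    { toFun := fun y => WithLp.toLp 1 fun k =>
        c⁻¹ * ∫ z : UnitAddTorus d, g (τ z) y * conj (AddCircle.toCircle (z k) : ℂ)
      map_add' := fun y y' => by
        ext k
        simp only [map_add, add_mul, PiLp.add_apply]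
        rw [integral_add (hint y k) (hint y' k), mul_add]
      map_smul' := fun r y => by
        ext k
        simp only [map_smul, smul_eq_mul, PiLp.smul_apply, RingHom.id_apply, mul_assoc]
        rw [integral_const_mul]
        ring }
  have hq₀ : ∀ y k, q₀ y k =
      c⁻¹ * ∫ z : UnitAddTorus d, g (τ z) y * conj (AddCircle.toCircle (z k) : ℂ) :=
    fun _ _ => rfl
  have hbound : ∀ y, ‖q₀ y‖ ≤ C * ‖y‖ := by
    intro y
    have h2 := sum_norm_integral_mul_conj_le (hmeas y) (fun z => hg (τ z) y)
    rw [PiLp.norm_eq_of_L1]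
    simp only [hq₀, norm_mul, norm_inv, ← Finset.mul_sum]
    calc ‖c‖⁻¹ * _ ≤ ‖c‖⁻¹ * (‖y‖ * torusL1 d) := by gcongr
      _ = (torusL1 d * ‖c‖⁻¹) * ‖y‖ := by ring
      _ ≤ C * ‖y‖ := by gcongr
  refine ⟨q₀.mkContinuous C hbound, fun a => ?_,
    LinearMap.mkContinuous_norm_le _ ((torusL1_nonneg d).trans hC.le) _⟩
  ext k
  change q₀ (I a) k = a k
  have hτ : ∀ z j, τ z j = σ (z j) := fun _ _ => rfl
  rw [hq₀]
  simp only [hgI, hτ, Finset.sum_mul, mul_assoc]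
  rw [integral_finsetSum]
  -- Orthogonality leaves only the term `j = k`, equal to `c * a k`; the factor `c⁻¹` in `q₀`
  -- cancels `c`.
  · simp only [integral_const_mul]
    simp only [torus_integral_comp_mul_conj (fun x => (AddCircle.toCircle (σ x) : ℂ)), ← hcdef]
    simp only [mul_ite, mul_zero, Finset.sum_ite_eq', Finset.mem_univ, if_true]
    field_simp
  · intro j _
    refine Integrable.const_mul (Integrable.of_bound (C := 1) ?_
      (Eventually.of_forall fun z => by simp)) _
    refine AEStronglyMeasurable.mul ?_ (continuous_conj_toCircle_apply k).aestronglyMeasurable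
    exact ((continuous_coe_toCircle.measurable.comp σ.measurable).comp
      (measurable_pi_apply j)).aestronglyMeasurable

variable {X : Type u} [NormedAddCommGroup X] [NormedSpace ℂ X]

theorem exists_projection_norm_le (e : X ≃ₗᵢ[ℂ] PiLp 1 (fun _ : d => ℂ)) (I : X →ₗᵢ[ℂ] Y) {C : ℝ}
    (hC : torusL1 d < C) :
    ∃ P : Y →L[ℂ] LinearMap.range I.toLinearMap,
      (∀ x : LinearMap.range I.toLinearMap, P x = x) ∧ ‖P‖ ≤ C := by
  obtain ⟨q, hq, hqC⟩ := exists_leftInverse_norm_le (I.comp e.symm.toLinearIsometry) hC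
  have hC0 : 0 ≤ C := (torusL1_nonneg d).trans hC.le
  let P₀ : Y →ₗ[ℂ] LinearMap.range I.toLinearMap :=
    I.toLinearMap.rangeRestrict ∘ₗ e.symm.toLinearEquiv.toLinearMap ∘ₗ q.toLinearMap
  have hP₀ : ∀ y, (P₀ y : Y) = I (e.symm (q y)) := fun _ => rfl
  refine ⟨P₀.mkContinuous C fun y => ?_, ?_, LinearMap.mkContinuous_norm_le _ hC0 _⟩
  · rw [Submodule.coe_norm, hP₀, I.norm_map, e.symm.norm_map]
    exact q.le_of_opNorm_le hqC y
  · rintro ⟨_, x, rfl⟩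
    apply Subtype.ext
    rw [LinearMap.mkContinuous_apply, hP₀]
    have := hq (e x)
    simp only [LinearIsometry.coe_comp, Function.comp_apply,
      LinearIsometryEquiv.coe_toLinearIsometry, LinearIsometryEquiv.symm_apply_apply] at this
    simp [this]

end Upper

/-! ### Lower bound: averaging over translations in the continuous functions on the torus -/

section Lower

variable {d : Type}

/-- The translates of a continuous function on the torus. -/
noncomputable def torusTranslate (h : C(UnitAddTorus d, ℂ)) :
    C(UnitAddTorus d, C(ULift.{v} (UnitAddTorus d), ℂ)) :=
  ContinuousMap.curry ⟨fun p : UnitAddTorus d × ULift.{v} (UnitAddTorus d) => h (p.1 + p.2.down),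
    h.continuous.comp (continuous_fst.add (continuous_uliftDown.comp continuous_snd))⟩

theorem torusTranslate_apply (h : C(UnitAddTorus d, ℂ)) (g : UnitAddTorus d)
    (x : ULift.{v} (UnitAddTorus d)) : torusTranslate h g x = h (g + x.down) := rfl

variable [Fintype d]

/-- The linear functions `z ↦ ∑ aₖ zₖ` as continuous functions on the torus. -/
noncomputable def torusLinear (d : Type) [Fintype d] :
    PiLp 1 (fun _ : d => ℂ) →ₗ[ℂ] C(ULift.{v} (UnitAddTorus d), ℂ) where
  toFun a := ⟨fun x => ∑ k, a k * (AddCircle.toCircle (x.down k) : ℂ),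
    continuous_finsetSum _ fun k _ => continuous_const.mul
      (continuous_coe_toCircle.comp ((continuous_apply k).comp continuous_uliftDown))⟩
  map_add' a b := by
    ext x
    simp [add_mul, Finset.sum_add_distrib]
  map_smul' c a := by
    ext x
    simp [Finset.mul_sum, mul_assoc]

theorem torusLinear_apply (a : PiLp 1 (fun _ : d => ℂ)) (x : ULift.{v} (UnitAddTorus d)) :
    torusLinear d a x = ∑ k, a k * (AddCircle.toCircle (x.down k) : ℂ) := rfl

theorem norm_torusLinear (a : PiLp 1 (fun _ : d => ℂ)) : ‖torusLinear.{v} d a‖ = ‖a‖ := by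
  rw [PiLp.norm_eq_of_L1]
  refine le_antisymm ?_ ?_
  · refine (ContinuousMap.norm_le _ (Finset.sum_nonneg fun _ _ => norm_nonneg _)).2 fun x => ?_
    rw [torusLinear_apply]
    refine (norm_sum_le _ _).trans (le_of_eq ?_)
    simp
  · choose x hx using fun k => exists_toCircle_mul_eq_norm (a k)
    have := (torusLinear.{v} d a).norm_coe_le_norm ⟨x⟩
    rw [torusLinear_apply] at this
    simp only [hx] at this
    rw [← Complex.ofReal_sum, Complex.norm_real] at this
    exact (le_abs_self _).trans this

/-- The isometric embedding of `ℓ₁` into the continuous functions on the torus. -/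
noncomputable def torusEmbedding (d : Type) [Fintype d] :
    PiLp 1 (fun _ : d => ℂ) →ₗᵢ[ℂ] C(ULift.{v} (UnitAddTorus d), ℂ) :=
  ⟨torusLinear d, norm_torusLinear⟩

theorem torusEmbedding_apply (a : PiLp 1 (fun _ : d => ℂ)) (x : ULift.{v} (UnitAddTorus d)) :
    torusEmbedding d a x = ∑ k, a k * (AddCircle.toCircle (x.down k) : ℂ) := rfl

theorem integrable_conj_smul_translate (h : C(UnitAddTorus d, ℂ)) (k : d) :
    Integrable fun g : UnitAddTorus d =>
      conj (AddCircle.toCircle (g k) : ℂ) • torusTranslate.{v} h g :=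
  torus_integrable ((continuous_conj_toCircle_apply k).smul (torusTranslate.{v} h).continuous)

theorem integrable_conj_mul {f : UnitAddTorus d → ℂ} (hf : Continuous f) (k : d) :
    Integrable fun g : UnitAddTorus d => conj (AddCircle.toCircle (g k) : ℂ) * f g :=
  torus_integrable ((continuous_conj_toCircle_apply k).mul hf)

/-- Averaging translates against a conjugate character isolates one Fourier mode: the substitution
`g ↦ g + x` pulls out the character at `x`. -/
theorem integral_conj_smul_translate [DecidableEq d] (h : C(UnitAddTorus d, ℂ)) (k : d) :
    ∫ g : UnitAddTorus d, conj (AddCircle.toCircle (g k) : ℂ) • torusTranslate.{v} h g =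
      torusEmbedding d (PiLp.single 1 k
        (∫ g : UnitAddTorus d, conj (AddCircle.toCircle (g k) : ℂ) * h g)) := by
  ext x
  rw [ContinuousMap.integral_apply (integrable_conj_smul_translate h k),
    torusEmbedding_apply, Finset.sum_eq_single k (fun j _ hj => by simp [hj]) (by simp)]
  simp only [ContinuousMap.smul_apply, torusTranslate_apply, smul_eq_mul, PiLp.single_apply,
    if_true]
  rw [← integral_mul_const, ← integral_add_right_eq_self
    (fun g : UnitAddTorus d => conj (AddCircle.toCircle (g k) : ℂ) * h g *
      (AddCircle.toCircle (x.down k) : ℂ)) x.down]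
  refine integral_congr_ae (Eventually.of_forall fun g => ?_)
  have h1 : conj (AddCircle.toCircle (x.down k) : ℂ) * (AddCircle.toCircle (x.down k) : ℂ) = 1 := by
    rw [mul_comm, Complex.mul_conj, Complex.normSq_eq_norm_sq]
    simp
  simp only [Pi.add_apply, AddCircle.toCircle_add, Circle.coe_mul, map_mul]
  linear_combination (-conj (AddCircle.toCircle (g k) : ℂ) * h (g + x.down)) * h1

theorem sub_le_sq_div_max {s δ : ℝ} (hδ : 0 < δ) : s - δ ≤ s ^ 2 / max s δ := by
  rcases le_total s δ with h | h
  · rw [max_eq_right h]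
    have : 0 ≤ s ^ 2 / δ := by positivity
    linarith
  · rw [max_eq_left h, sq, mul_self_div_self]
    linarith

/-- Let `S = ∑ zₖ` and let `h` approximate its sign. The Fourier coefficients `b k` of `h` sum to `∫
S̄ h`, nearly `torusL1 d`. They are also averages of coordinates of `q` on translates of `h`, with
unimodular weights, so their sum is at most `‖q‖`. -/
theorem torusL1_le_norm_leftInverse
    (q : C(ULift.{v} (UnitAddTorus d), ℂ) →L[ℂ] PiLp 1 (fun _ : d => ℂ))
    (hq : ∀ a, q (torusEmbedding d a) = a) : torusL1 d ≤ ‖q‖ := by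
  classical
  refine le_of_forall_pos_le_add fun δ hδ => ?_
  let S : C(UnitAddTorus d, ℂ) := ⟨fun x => ∑ k, (AddCircle.toCircle (x k) : ℂ),
    continuous_finsetSum _ fun k _ => continuous_coe_toCircle.comp (continuous_apply k)⟩
  have hmax : ∀ x, 0 < max ‖S x‖ δ := fun x => lt_max_of_lt_right hδ
  -- A continuous substitute for `S / |S|`: the cutoff `δ` handles the zeros of `S` and costs at
  -- most `δ` in the final integral.
  let h : C(UnitAddTorus d, ℂ) := ⟨fun x => S x * ((max ‖S x‖ δ)⁻¹ : ℝ), by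
    refine S.continuous.mul (Complex.continuous_ofReal.comp ?_)
    exact (S.continuous.norm.max continuous_const).inv₀ fun x => (hmax x).ne'⟩
  have hh : ∀ x, h x = S x * ((max ‖S x‖ δ)⁻¹ : ℝ) := fun _ => rfl
  have hS : ∀ x, S x = ∑ k, (AddCircle.toCircle (x k) : ℂ) := fun _ => rfl
  have hh1 : ∀ x, ‖h x‖ ≤ 1 := fun x => by
    rw [hh, norm_mul, Complex.norm_real, norm_inv, Real.norm_of_nonneg (hmax x).le,
      ← div_eq_mul_inv, div_le_one (hmax x)]
    exact le_max_left _ _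
  have htr : ∀ g, ‖torusTranslate.{v} h g‖ ≤ 1 := fun g =>
    (ContinuousMap.norm_le _ zero_le_one).2 fun x => hh1 _
  let b : d → ℂ := fun k => ∫ g : UnitAddTorus d, conj (AddCircle.toCircle (g k) : ℂ) * h g
  have hb : ∀ k, b k = ∫ g : UnitAddTorus d, conj (AddCircle.toCircle (g k) : ℂ) * h g :=
    fun _ => rfl
  have hqc : ∀ k, Continuous fun g => q (torusTranslate.{v} h g) k := fun k =>
    (PiLp.continuous_apply 1 (fun _ : d => ℂ) k).comp
      (q.continuous.comp (torusTranslate.{v} h).continuous)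
  -- `q` commutes with the Bochner integral of translates, whose value lies in the embedded `ℓ₁`,
  -- where `q` inverts the embedding.
  have hbk : ∀ k, b k = ∫ g : UnitAddTorus d, conj (AddCircle.toCircle (g k) : ℂ) *
      q (torusTranslate.{v} h g) k := by
    intro k
    have h1 := congrArg (fun y => q y k) (integral_conj_smul_translate.{v} h k)
    simp only [hq, PiLp.single_apply, if_true] at h1
    rw [hb, ← h1]
    have h2 := ((PiLp.proj 1 (𝕜 := ℂ) (fun _ : d => ℂ) k).comp q).integral_comp_comm 
      (integrable_conj_smul_translate.{v} h k)
    refine h2.symm.trans ?_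
    refine integral_congr_ae (Eventually.of_forall fun g => ?_)
    simp
  have hsum1 : ∑ k, b k = ∫ g : UnitAddTorus d, ∑ k, conj (AddCircle.toCircle (g k) : ℂ) *
      q (torusTranslate.{v} h g) k := by
    rw [integral_finsetSum _ fun k _ => integrable_conj_mul (hqc k) k]
    exact Finset.sum_congr rfl fun k _ => hbk k
  have hle : ‖∑ k, b k‖ ≤ ‖q‖ := by
    rw [hsum1]
    refine (norm_integral_le_of_norm_le_const (C := ‖q‖)
      (Eventually.of_forall fun g => ?_)).trans_eq (by simp)
    have h3 : ‖q (torusTranslate.{v} h g)‖ ≤ ‖q‖ := q.unit_le_opNorm _ (htr g)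
    rw [PiLp.norm_eq_of_L1] at h3
    refine ((norm_sum_le _ _).trans (le_of_eq ?_)).trans h3
    simp
  have hsum2 : ∑ k, b k = ((∫ g, ‖S g‖ ^ 2 / max ‖S g‖ δ : ℝ) : ℂ) := by
    simp only [hb]
    rw [← integral_finsetSum _ fun k _ => integrable_conj_mul h.continuous k]
    refine Eq.trans ?_ integral_ofReal
    refine integral_congr_ae (Eventually.of_forall fun g => ?_)
    dsimp only
    rw [← Finset.sum_mul, ← map_sum, ← hS, hh, ← mul_assoc, mul_comm (conj (S g)),
      Complex.mul_conj, Complex.normSq_eq_norm_sq, div_eq_mul_inv]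
    push_cast
    rfl
  have hcont : Continuous fun g => ‖S g‖ ^ 2 / max ‖S g‖ δ :=
    (S.continuous.norm.pow 2).div (S.continuous.norm.max continuous_const) fun x => (hmax x).ne'
  have hge : torusL1 d - δ ≤ ∫ g, ‖S g‖ ^ 2 / max ‖S g‖ δ := by
    have : torusL1 d - δ = ∫ g, (‖S g‖ - δ) := by
      rw [integral_sub (torus_integrable S.continuous.norm) (integrable_const _)]
      simp [torusL1, hS]
    rw [this]
    exact integral_mono (torus_integrable (S.continuous.norm.sub continuous_const))
      (torus_integrable hcont) fun g => sub_le_sq_div_max hδ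
  rw [hsum2, Complex.norm_real] at hle
  have := (le_abs_self _).trans hle
  linarith

end Lower

/-! ### Both bounds combined -/

section ProjectionConstant

variable {d : Type} [Fintype d] {X : Type u} [NormedAddCommGroup X] [NormedSpace ℂ X]

theorem le_norm_projection_of_le_norm_leftInverse {E X Y : Type*}
    [NormedAddCommGroup E] [NormedSpace ℂ E] [NormedAddCommGroup X] [NormedSpace ℂ X]
    [NormedAddCommGroup Y] [NormedSpace ℂ Y] {L : ℝ} (j : E →ₗᵢ[ℂ] Y)
    (hj : ∀ q : Y →L[ℂ] E, (∀ a, q (j a) = a) → L ≤ ‖q‖) (e : X ≃ₗᵢ[ℂ] E)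
    (I : X →ₗᵢ[ℂ] Y) (hI : ∀ x, I x = j (e x)) (P : Y →L[ℂ] LinearMap.range I.toLinearMap)
    (hP : ∀ x : LinearMap.range I.toLinearMap, P x = x) : L ≤ ‖P‖ := by
  let q₀ : Y →ₗ[ℂ] E :=
    e.toLinearEquiv.toLinearMap ∘ₗ I.equivRange.symm.toLinearEquiv.toLinearMap ∘ₗ P.toLinearMap
  have hq₀ : ∀ y, q₀ y = e (I.equivRange.symm (P y)) := fun _ => rfl
  have hn : ∀ y, ‖q₀ y‖ ≤ ‖P‖ * ‖y‖ := fun y => by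
    rw [hq₀, e.norm_map, I.equivRange.symm.norm_map]
    exact P.le_opNorm y
  refine (hj (q₀.mkContinuous ‖P‖ hn) fun a => ?_).trans
    (LinearMap.mkContinuous_norm_le _ P.opNorm_nonneg _)
  rw [LinearMap.mkContinuous_apply, hq₀]
  have h1 : j a = (I.equivRange (e.symm a) : Y) := by
    simp [hI]
  rw [h1, hP]
  simp

/-- The projection constant of a space isometric to `ℓ₁`. -/
theorem projectionConstant_eq_torusL1 (e : X ≃ₗᵢ[ℂ] PiLp 1 (fun _ : d => ℂ)) :
    projectionConstant.{u, v} X = ENNReal.ofReal (torusL1 d) := by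
  refine le_antisymm (sSup_le ?_) ?_
  · rintro _ ⟨Y, _, _, _, I, -, rfl⟩
    refine ENNReal.le_of_forall_pos_le_add fun ε hε _ => ?_
    obtain ⟨P, hP, hPC⟩ := exists_projection_norm_le e I
      (lt_add_of_pos_right (torusL1 d) (NNReal.coe_pos.2 hε))
    refine (iInf₂_le P hP).trans ?_
    rw [← ofReal_norm]
    refine (ENNReal.ofReal_le_ofReal hPC).trans_eq ?_
    rw [ENNReal.ofReal_add (torusL1_nonneg d) ε.coe_nonneg, ENNReal.ofReal_coe_nnreal]
  -- The upper bound construction also supplies the complementation that makes the function space on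
  -- the torus admissible in the supremum.
  · obtain ⟨P, hP, -⟩ := exists_projection_norm_le e
      ((torusEmbedding.{v} d).comp e.toLinearIsometry) (lt_add_one (torusL1 d))
    refine le_trans ?_ (le_sSup ⟨C(ULift.{v} (UnitAddTorus d), ℂ), inferInstance, inferInstance,
      inferInstance, (torusEmbedding.{v} d).comp e.toLinearIsometry, ⟨P, hP⟩, rfl⟩)
    refine le_iInf₂ fun Q hQ => ?_
    rw [← ofReal_norm]
    exact ENNReal.ofReal_le_ofReal 
      (le_norm_projection_of_le_norm_leftInverse _ torusL1_le_norm_leftInverse e _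
        (fun _ => rfl) Q hQ)

end ProjectionConstant

/-! ### The torus mean -/

open scoped Pointwise in
theorem torusMean_eq_integral (n : ℕ) {f : (Fin n → ℂ) → ℝ} (hf : Continuous f) :
    torusMean n f = ∫ x : UnitAddTorus (Fin n), f fun k => (AddCircle.toCircle (x k) : ℂ) := by
  have hmp := measurePreserving_pi (fun _ : Fin n => (volume : Measure ℝ).restrict (Set.Ioc 0 (0 + 1)))
    (fun _ : Fin n => (volume : Measure UnitAddCircle))
    (fun _ => UnitAddCircle.measurePreserving_mk 0)
  have hcont : Continuous fun x : UnitAddTorus (Fin n) =>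
      f fun k => (AddCircle.toCircle (x k) : ℂ) :=
    hf.comp (continuous_pi fun k => continuous_coe_toCircle.comp (continuous_apply k))
  rw [volume_pi, ← hmp.map_eq, integral_map hmp.measurable.aemeasurable
    hcont.aestronglyMeasurable, ← Measure.restrict_pi_pi,
    setIntegral_congr_set Measure.univ_pi_Ioc_ae_eq_Icc, ← volume_pi, torusMean]
  -- Scaling the unit cube to side `2π` yields the Jacobian `(2π)⁻ⁿ`, the normalization in
  -- `torusMean`.
  have hs := Measure.setIntegral_comp_smul_of_pos (volume : Measure (Fin n → ℝ))
    (fun t => f fun k => Complex.exp (Complex.I * (t k : ℂ)))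
    (Set.Icc (fun _ => 0) (fun _ => 0 + 1)) Real.two_pi_pos
  have hset : (2 * Real.pi) • Set.Icc (fun _ : Fin n => (0 : ℝ)) (fun _ => 0 + 1) =
      Set.Icc (0 : Fin n → ℝ) (fun _ => 2 * Real.pi) := by
    ext t
    simp only [Set.mem_smul_set_iff_inv_smul_mem₀ Real.two_pi_pos.ne', Set.mem_Icc, Pi.le_def,
      Pi.smul_apply, smul_eq_mul, Pi.zero_apply, zero_add, inv_mul_le_one₀ Real.two_pi_pos,
      mul_nonneg_iff_of_pos_left (inv_pos.2 Real.two_pi_pos)]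
  rw [hset, Module.finrank_fin_fun, smul_eq_mul] at hs
  rw [← hs]
  refine integral_congr_ae (Eventually.of_forall fun t => ?_)
  dsimp only
  congr 1
  ext k
  rw [AddCircle.toCircle_apply_mk, Circle.coe_exp]
  congr 1
  simp
  ring

theorem torusMean_norm_sum (n : ℕ) : (torusMean n fun z => ‖∑ k, z k‖) = torusL1 (Fin n) :=
  torusMean_eq_integral n (by fun_prop)

/-! ### Convergence of first absolute moments -/

/-- Truncation only matters where `|x| > M`, and there `|x| ≤ x² / M`; second moments thus control
the truncation error uniformly. -/
theorem abs_sub_min_le {x M : ℝ} (hM : 0 < M) : |(|x| - min |x| M)| ≤ x ^ 2 / M := by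
  rw [← sq_abs x]
  set s := |x|
  rcases le_total s M with h | h
  · rw [min_eq_left h, sub_self, abs_zero]
    positivity
  · rw [min_eq_right h, abs_of_nonneg (sub_nonneg.2 h), le_div_iff₀ hM]
    nlinarith [sq_nonneg (s - M)]

theorem dist_integral_abs_integral_min_le {μ : Measure ℝ} [IsProbabilityMeasure μ]
    (hi : Integrable (fun x : ℝ => x ^ 2) μ) {K M : ℝ} (hM : 0 < M) (hK : ∫ x, x ^ 2 ∂μ ≤ K) :
    dist (∫ x, |x| ∂μ) (∫ x, min |x| M ∂μ) ≤ K / M := by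
  have h1 : Integrable (fun x : ℝ => |x|) μ := by
    refine (hi.add (integrable_const 1)).mono' (by fun_prop) (Eventually.of_forall fun x => ?_)
    rw [Real.norm_eq_abs, abs_abs, Pi.add_apply, ← sq_abs]
    nlinarith [sq_nonneg (|x| - 1), abs_nonneg x]
  have h2 : Integrable (fun x : ℝ => min |x| M) μ := h1.inf (integrable_const M)
  rw [dist_eq_norm, ← integral_sub h1 h2]
  refine (norm_integral_le_of_norm_le (hi.div_const M)
    (Eventually.of_forall fun x => abs_sub_min_le hM)).trans ?_
  rw [integral_div]
  gcongr

/-- Weak convergence and bounded second moments give convergence of first absolute moments. -/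
theorem tendsto_integral_abs_of_tendsto {ν : ℕ → ProbabilityMeasure ℝ} {μ : ProbabilityMeasure ℝ}
    (h : Tendsto ν atTop (𝓝 μ)) {K : ℝ} (hν : ∀ n, Integrable (fun x : ℝ => x ^ 2) (ν n : Measure ℝ))
    (hνK : ∀ n, ∫ x, x ^ 2 ∂(ν n : Measure ℝ) ≤ K)
    (hμ : Integrable (fun x : ℝ => x ^ 2) (μ : Measure ℝ)) :
    Tendsto (fun n => ∫ x, |x| ∂(ν n : Measure ℝ)) atTop (𝓝 (∫ x, |x| ∂(μ : Measure ℝ))) := by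
  set K' := max K (∫ x, x ^ 2 ∂(μ : Measure ℝ))
  rw [Metric.tendsto_nhds]
  intro ε hε
  have hK' : 0 ≤ K' := le_max_of_le_right (integral_nonneg fun _ => sq_nonneg _)
  -- Makes each of the two truncation errors less than `ε / 3`; the `+ 1` keeps `M` positive when
  -- `K' = 0`.
  set M := 3 * (K' + 1) / ε with hMdef
  have hM : 0 < M := by positivity
  have hKM : K' / M < ε / 3 := by
    rw [hMdef, div_div_eq_mul_div, div_lt_div_iff₀ (by positivity) (by positivity)]
    nlinarith
  let f : BoundedContinuousFunction ℝ ℝ := BoundedContinuousFunction.ofNormedAddCommGroup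
    (fun x => min |x| M) (by fun_prop) M (fun x => by
      rw [Real.norm_of_nonneg (le_min (abs_nonneg _) hM.le)]
      exact min_le_right _ _)
  filter_upwards [(Metric.tendsto_nhds.1
    ((ProbabilityMeasure.tendsto_iff_forall_integral_tendsto.1 h) f)) (ε / 3) (by positivity)]
    with n hn
  have h1 := dist_integral_abs_integral_min_le (K := K') (hν n) hM
    ((hνK n).trans (le_max_left _ _))
  have h2 := dist_integral_abs_integral_min_le (K := K') hμ hM (le_max_right K _)
  rw [dist_comm] at h2
  have hn' : dist (∫ x, min |x| M ∂(ν n : Measure ℝ)) (∫ x, min |x| M ∂(μ : Measure ℝ)) < ε / 3 :=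
    hn
  refine (dist_triangle4 _ _ _ _).trans_lt ((add_lt_add_of_lt_of_le (add_lt_add_of_le_of_lt h1 hn')
    h2).trans ?_)
  linarith

theorem integral_abs_gaussianReal :
    ∫ x, |x| ∂(ProbabilityTheory.gaussianReal 0 1) = 2 / Real.sqrt (2 * Real.pi) := by
  rw [ProbabilityTheory.integral_gaussianReal_eq_integral_smul one_ne_zero]
  have h1 : ∀ x : ℝ, ProbabilityTheory.gaussianPDFReal 0 1 x • |x| =
      (Real.sqrt (2 * Real.pi))⁻¹ * (|x| * Real.exp (-(1 / 2) * |x| ^ 2)) := by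
    intro x
    rw [ProbabilityTheory.gaussianPDFReal, sq_abs]
    simp
    ring_nf
  simp only [h1]
  rw [integral_const_mul, integral_comp_abs (f := fun x => x * Real.exp (-(1 / 2) * x ^ 2))]
  have h2 := integral_rpow_mul_exp_neg_mul_rpow (p := 2) (q := 1) (b := 1 / 2) (by norm_num)
    (by norm_num) (by norm_num)
  simp only [Real.rpow_one, Real.rpow_two] at h2
  rw [h2]
  have h3 : ((1 : ℝ) / 2) ^ (-(1 + 1) / 2 : ℝ) = 2 := by
    norm_num [Real.rpow_neg_one]
  have h4 : Real.Gamma ((1 + 1) / 2) = 1 := by norm_num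
  rw [h3, h4]
  ring

/-! ### The real part of a random sum of unimodular numbers -/

theorem integral_abs_re_toCircle :
    ∫ x : UnitAddCircle, |(AddCircle.toCircle x : ℂ).re| = 2 / Real.pi := by
  -- Starting at `-1/4` makes the cosine nonnegative on the first half period; the second half is
  -- its shift by `1/2`, which only flips the sign.
  rw [← UnitAddCircle.intervalIntegral_preimage (-(1 / 4))]
  have h0 : ∀ t : ℝ, (AddCircle.toCircle (t : UnitAddCircle) : ℂ).re = Real.cos (2 * Real.pi * t) := by
    intro t
    rw [AddCircle.toCircle_apply_mk, Circle.coe_exp, Complex.exp_ofReal_mul_I_re, div_one]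
  simp only [h0]
  have hint : ∀ a b : ℝ, IntervalIntegrable (fun t => |Real.cos (2 * Real.pi * t)|) volume a b :=
    fun a b => (by fun_prop : Continuous fun t : ℝ => |Real.cos (2 * Real.pi * t)|).intervalIntegrable a b
  rw [← intervalIntegral.integral_add_adjacent_intervals (b := 1 / 4) (hint _ _) (hint _ _)]
  have hpi := Real.pi_pos
  have h1 : ∫ t in (-(1 / 4) : ℝ)..(1 / 4), |Real.cos (2 * Real.pi * t)| = Real.pi⁻¹ := by
    have : ∫ t in (-(1 / 4) : ℝ)..(1 / 4), |Real.cos (2 * Real.pi * t)| =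
        ∫ t in (-(1 / 4) : ℝ)..(1 / 4), Real.cos (2 * Real.pi * t) := by
      refine intervalIntegral.integral_congr fun t ht => ?_
      rw [Set.uIcc_of_le (by norm_num)] at ht
      exact abs_of_nonneg (Real.cos_nonneg_of_mem_Icc ⟨by nlinarith [ht.1], by nlinarith [ht.2]⟩)
    rw [this, intervalIntegral.integral_comp_mul_left (fun t => Real.cos t) Real.two_pi_pos.ne',
      integral_cos]
    have e1 : 2 * Real.pi * (1 / 4) = Real.pi / 2 := by ring
    have e2 : 2 * Real.pi * (-(1 / 4)) = -(Real.pi / 2) := by ring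
    rw [e1, e2, Real.sin_neg, Real.sin_pi_div_two, smul_eq_mul]
    field_simp
    norm_num
  have h2 : ∫ t in (1 / 4 : ℝ)..(-(1 / 4) + 1), |Real.cos (2 * Real.pi * t)| = Real.pi⁻¹ := by
    have h3 := intervalIntegral.integral_comp_add_right
      (fun t => |Real.cos (2 * Real.pi * t)|) (1 / 2 : ℝ) (a := -(1 / 4)) (b := 1 / 4)
    have e1 : (-(1 / 4) : ℝ) + 1 / 2 = 1 / 4 := by norm_num
    have e2 : (1 / 4 : ℝ) + 1 / 2 = -(1 / 4) + 1 := by norm_num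
    rw [e1, e2] at h3
    rw [← h1, ← h3]
    refine intervalIntegral.integral_congr fun t _ => ?_
    rw [show 2 * Real.pi * (t + 1 / 2) = 2 * Real.pi * t + Real.pi by ring, Real.cos_add_pi,
      abs_neg]
  rw [h1, h2]
  field_simp
  norm_num

theorem integral_abs_re_toCircle_mul (w : ℂ) :
    ∫ x : UnitAddCircle, |((AddCircle.toCircle x : ℂ) * w).re| = 2 / Real.pi * ‖w‖ := by
  obtain ⟨y, hy⟩ := exists_toCircle_mul_eq_norm w
  rw [← integral_add_right_eq_self _ y, ← integral_abs_re_toCircle, ← integral_mul_const]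
  refine integral_congr_ae (Eventually.of_forall fun x => ?_)
  dsimp only
  rw [AddCircle.toCircle_add, Circle.coe_mul, mul_assoc, mul_comm (AddCircle.toCircle y : ℂ), hy,
    Complex.re_mul_ofReal, abs_mul, abs_norm]

section

variable {d : Type*} [Fintype d]

theorem continuous_sum_toCircle :
    Continuous fun x : UnitAddTorus d => ∑ k, (AddCircle.toCircle (x k) : ℂ) :=
  continuous_finsetSum _ fun k _ => continuous_coe_toCircle.comp (continuous_apply k)

/-- A common rotation of all coordinates preserves the measure. Averaging over that rotation first,
by Fubini, replaces `|Re S|` by `(2/π) |S|`. This reduces the complex problem to a real central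
limit theorem. -/
theorem integral_abs_re_sum_toCircle :
    ∫ x : UnitAddTorus d, |(∑ k, (AddCircle.toCircle (x k) : ℂ)).re| =
      2 / Real.pi * torusL1 d := by
  have h1 : ∀ y : UnitAddCircle,
      ∫ x : UnitAddTorus d, |((AddCircle.toCircle y : ℂ) * ∑ k, (AddCircle.toCircle (x k) : ℂ)).re| =
        ∫ x : UnitAddTorus d, |(∑ k, (AddCircle.toCircle (x k) : ℂ)).re| := by
    intro y
    rw [← integral_add_right_eq_self
      (fun x : UnitAddTorus d => |(∑ k, (AddCircle.toCircle (x k) : ℂ)).re|) (fun _ => y)]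
    refine integral_congr_ae (Eventually.of_forall fun x => ?_)
    dsimp only
    rw [Finset.mul_sum]
    congr! 3 with k
    rw [Pi.add_apply, AddCircle.toCircle_add, Circle.coe_mul, mul_comm]
  have h2 : ∫ y : UnitAddCircle, ∫ x : UnitAddTorus d,
      |((AddCircle.toCircle y : ℂ) * ∑ k, (AddCircle.toCircle (x k) : ℂ)).re| =
        ∫ x : UnitAddTorus d, |(∑ k, (AddCircle.toCircle (x k) : ℂ)).re| := by
    simp only [h1, integral_const, probReal_univ, one_smul]
  rw [← h2, integral_integral_swap]
  · simp only [integral_abs_re_toCircle_mul]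
    rw [integral_const_mul, torusL1]
  · have hc : Continuous (Function.uncurry fun (y : UnitAddCircle) (x : UnitAddTorus d) =>
        |((AddCircle.toCircle y : ℂ) * ∑ k, (AddCircle.toCircle (x k) : ℂ)).re|) :=
      (Complex.continuous_re.comp ((continuous_coe_toCircle.comp continuous_fst).mul
        (continuous_sum_toCircle.comp continuous_snd))).abs
    exact hc.integrable_of_hasCompactSupport (HasCompactSupport.of_compactSpace _)

theorem integral_norm_sum_toCircle_sq :
    ∫ x : UnitAddTorus d, ‖∑ k, (AddCircle.toCircle (x k) : ℂ)‖ ^ 2 = Fintype.card d := by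
  classical
  have h1 : ∀ x : UnitAddTorus d, ((‖∑ k, (AddCircle.toCircle (x k) : ℂ)‖ ^ 2 : ℝ) : ℂ) =
      ∑ j, ∑ k, (AddCircle.toCircle (x j) : ℂ) * conj (AddCircle.toCircle (x k) : ℂ) := by
    intro x
    rw [← Finset.sum_mul_sum, ← map_sum, Complex.mul_conj, Complex.normSq_eq_norm_sq]
  have hint : ∀ j k, Integrable fun x : UnitAddTorus d =>
      (AddCircle.toCircle (x j) : ℂ) * conj (AddCircle.toCircle (x k) : ℂ) := fun j k =>
    torus_integrable ((continuous_coe_toCircle.comp (continuous_apply j)).mul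
      (continuous_conj_toCircle_apply k))
  have h2 : ∀ x : UnitAddCircle,
      (AddCircle.toCircle x : ℂ) * conj (AddCircle.toCircle x : ℂ) = 1 := fun x => by
    rw [Complex.mul_conj, Complex.normSq_eq_norm_sq]
    simp
  have h3 : ((∫ x : UnitAddTorus d, ‖∑ k, (AddCircle.toCircle (x k) : ℂ)‖ ^ 2 : ℝ) : ℂ) =
      Fintype.card d := by
    refine integral_ofReal.symm.trans ?_
    refine (integral_congr_ae (Eventually.of_forall h1)).trans ?_
    rw [integral_finsetSum _ fun j _ => integrable_finsetSum _ fun k _ => hint j k]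
    simp only [integral_finsetSum _ fun k _ => hint _ k,
      torus_integral_comp_mul_conj (fun x => (AddCircle.toCircle x : ℂ)), h2]
    simp
  exact_mod_cast h3

end

/-! ### The asymptotics of the `L₁`-norm of a random sum of unimodular numbers -/

/-- The normalized real part on the circle. -/
noncomputable def circleRe (x : UnitAddCircle) : ℝ := Real.sqrt 2 * (AddCircle.toCircle x : ℂ).re

theorem continuous_circleRe : Continuous circleRe :=
  continuous_const.mul (Complex.continuous_re.comp continuous_coe_toCircle)

theorem integral_circleRe : ∫ x, circleRe x = 0 := by
  have h := integral_coe_toCircle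
  have h1 : ∫ x : UnitAddCircle, (AddCircle.toCircle x : ℂ).re = 0 := by
    have h2 : ∫ x : UnitAddCircle, (AddCircle.toCircle x : ℂ).re =
        (∫ x : UnitAddCircle, (AddCircle.toCircle x : ℂ)).re :=
      integral_re (continuous_coe_toCircle.integrable_of_hasCompactSupport
        (HasCompactSupport.of_compactSpace _))
    rw [h2, h, Complex.zero_re]
  simp only [circleRe]
  rw [integral_const_mul, h1, mul_zero]

/-- The double-angle formula `2 cos² θ = 1 + cos 2θ`; the second term has mean zero. -/
theorem integral_circleRe_sq : ∫ x, (circleRe ^ 2) x = 1 := by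
  have h1 : ∀ x, (circleRe ^ 2) x = 1 + (fourier 2 x : ℂ).re := by
    intro x
    have h2 : (fourier 2 x : ℂ) = (AddCircle.toCircle x : ℂ) * (AddCircle.toCircle x : ℂ) := by
      rw [show (2 : ℤ) = 1 + 1 from rfl, fourier_add, fourier_one]
    have h3 : (AddCircle.toCircle x : ℂ).re * (AddCircle.toCircle x : ℂ).re +
        (AddCircle.toCircle x : ℂ).im * (AddCircle.toCircle x : ℂ).im = 1 := by
      rw [← Complex.normSq_apply, Complex.normSq_eq_norm_sq]
      simp
    rw [h2, Complex.mul_re, Pi.pow_apply, circleRe, mul_pow, Real.sq_sqrt zero_le_two]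
    linear_combination h3
  have hint : Integrable fun x : UnitAddCircle => (fourier 2 x : ℂ) :=
    (fourier 2).continuous.integrable_of_hasCompactSupport (HasCompactSupport.of_compactSpace _)
  have h4 : ∫ x : UnitAddCircle, (fourier 2 x : ℂ).re = 0 := by
    have h5 : ∫ x : UnitAddCircle, (fourier 2 x : ℂ).re =
        (∫ x : UnitAddCircle, (fourier 2 x : ℂ)).re := integral_re hint
    rw [h5, UnitAddCircle.integral_fourier]
    simp
  simp only [h1]
  have h6 : Integrable fun x : UnitAddCircle => (fourier 2 x : ℂ).re := hint.re
  rw [integral_add (integrable_const _) h6, h4]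
  simp

/-- The normalized sum of independent copies of `circleRe`. -/
noncomputable def circleSum (n : ℕ) (x : UnitAddTorus (Fin n)) : ℝ :=
  (Real.sqrt n)⁻¹ * ∑ k, circleRe (x k)

theorem circleSum_eq (n : ℕ) (x : UnitAddTorus (Fin n)) : circleSum n x =
    (Real.sqrt n)⁻¹ * Real.sqrt 2 * (∑ k, (AddCircle.toCircle (x k) : ℂ)).re := by
  rw [circleSum, Complex.re_sum, mul_assoc, Finset.mul_sum Finset.univ _ (Real.sqrt 2)]
  rfl

theorem continuous_circleSum (n : ℕ) : Continuous (circleSum n) :=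
  continuous_const.mul
    (continuous_finsetSum _ fun k _ => continuous_circleRe.comp (continuous_apply k))

theorem charFun_circleSum (n : ℕ) (t : ℝ) :
    charFun ((volume : Measure (UnitAddTorus (Fin n))).map (circleSum n)) t =
      charFun ((volume : Measure UnitAddCircle).map circleRe) ((Real.sqrt n)⁻¹ * t) ^ n := by
  rw [charFun_apply_real, charFun_apply_real, integral_map
    (continuous_circleSum n).measurable.aemeasurable (by fun_prop), integral_map
    continuous_circleRe.measurable.aemeasurable (by fun_prop)]
  have h1 := integral_fintype_prod_volume_eq_pow (ι := Fin n) (fun x : UnitAddCircle =>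
    Complex.exp (((Real.sqrt n)⁻¹ * t : ℝ) * circleRe x * Complex.I))
  rw [Fintype.card_fin] at h1
  rw [← h1]
  refine integral_congr_ae (Eventually.of_forall fun x => ?_)
  dsimp only
  rw [← Complex.exp_sum, circleSum]
  congr 1
  push_cast
  rw [← Finset.sum_mul, ← Finset.mul_sum]
  ring

/-- Any bound uniform in `n` suffices, so the real part is crudely bounded by the modulus. -/
theorem integral_circleSum_sq_le (n : ℕ) : ∫ x, circleSum n x ^ 2 ≤ 2 := by
  have h1 : ∀ x, circleSum n x ^ 2 ≤
      2 / n * ‖∑ k, (AddCircle.toCircle (x k) : ℂ)‖ ^ 2 := by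
    intro x
    rw [circleSum_eq, mul_pow, mul_pow, inv_pow, Real.sq_sqrt (Nat.cast_nonneg n),
      Real.sq_sqrt zero_le_two, div_eq_mul_inv, mul_comm (2 : ℝ), ← sq_abs (Complex.re _)]
    gcongr
    exact Complex.abs_re_le_norm _
  have h2 : Integrable fun x : UnitAddTorus (Fin n) =>
      2 / (n : ℝ) * ‖∑ k, (AddCircle.toCircle (x k) : ℂ)‖ ^ 2 :=
    torus_integrable (continuous_const.mul (continuous_sum_toCircle.norm.pow 2))
  refine (integral_mono (torus_integrable ((continuous_circleSum n).pow 2)) h2 h1).trans ?_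
  rw [integral_const_mul, integral_norm_sum_toCircle_sq, Fintype.card_fin]
  rcases eq_or_ne (n : ℝ) 0 with h | h
  · simp [h]
  · rw [div_mul_cancel₀ _ h]

theorem tendsto_integral_abs_circleSum :
    Tendsto (fun n => ∫ x, |circleSum n x|) atTop (𝓝 (2 / Real.sqrt (2 * Real.pi))) := by
  let ν : ℕ → ProbabilityMeasure ℝ := fun n =>
    ⟨(volume : Measure (UnitAddTorus (Fin n))).map (circleSum n),
      Measure.isProbabilityMeasure_map (continuous_circleSum n).measurable.aemeasurable⟩
  have hν : ∀ n, (ν n : Measure ℝ) = (volume : Measure (UnitAddTorus (Fin n))).map (circleSum n) :=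
    fun _ => rfl
  let μ : ProbabilityMeasure ℝ := ⟨ProbabilityTheory.gaussianReal 0 1, inferInstance⟩
  have hμ : (μ : Measure ℝ) = ProbabilityTheory.gaussianReal 0 1 := rfl
  have hlim : Tendsto ν atTop (𝓝 μ) := by
    refine ProbabilityMeasure.tendsto_iff_tendsto_charFun.2 fun t => ?_
    simp only [hν, hμ, charFun_circleSum, ProbabilityTheory.charFun_gaussianReal]
    have := ProbabilityTheory.tendsto_charFun_inv_sqrt_mul_pow
      continuous_circleRe.measurable.aemeasurable integral_circleRe integral_circleRe_sq t
    simpa [neg_div] using this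
  have := tendsto_integral_abs_of_tendsto hlim (K := 2) (fun n => ?_) (fun n => ?_) ?_
  · rw [hμ, integral_abs_gaussianReal] at this
    refine this.congr fun n => ?_
    rw [hν, integral_map (continuous_circleSum n).measurable.aemeasurable (by fun_prop)]
  · rw [hν, integrable_map_measure (by fun_prop) (continuous_circleSum n).measurable.aemeasurable]
    exact torus_integrable ((continuous_circleSum n).pow 2)
  · rw [hν, integral_map (continuous_circleSum n).measurable.aemeasurable (by fun_prop)]
    exact integral_circleSum_sq_le n
  · exact (ProbabilityTheory.memLp_id_gaussianReal 2).integrable_sq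

/-- The limit constant is `(π/2) · (1/√2) · 2/√(2π)`: undo the average over rotations and the
variance normalization, then insert the Gaussian first absolute moment. -/
theorem tendsto_torusL1_div_sqrt :
    Tendsto (fun n : ℕ => torusL1 (Fin n) / Real.sqrt n) atTop (𝓝 (Real.sqrt Real.pi / 2)) := by
  have h1 : ∀ n : ℕ, torusL1 (Fin n) / Real.sqrt n =
      Real.pi / 2 / Real.sqrt 2 * ∫ x, |circleSum n x| := by
    intro n
    have h2 : ∀ x : UnitAddTorus (Fin n), |circleSum n x| = (Real.sqrt n)⁻¹ * Real.sqrt 2 *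
        |(∑ k, (AddCircle.toCircle (x k) : ℂ)).re| := fun x => by
      rw [circleSum_eq, abs_mul, abs_of_nonneg (a := (Real.sqrt n)⁻¹ * Real.sqrt 2) (by positivity)]
    simp only [h2]
    rw [integral_const_mul, integral_abs_re_sum_toCircle]
    have := Real.pi_ne_zero
    field_simp
  have h3 : Real.sqrt Real.pi / 2 = Real.pi / 2 / Real.sqrt 2 * (2 / Real.sqrt (2 * Real.pi)) := by
    rw [Real.sqrt_mul zero_le_two]
    have hp : Real.sqrt Real.pi ≠ 0 := (Real.sqrt_pos.2 Real.pi_pos).ne'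
    field_simp
    rw [Real.sq_sqrt Real.pi_pos.le, Real.sq_sqrt zero_le_two]
    ring
  rw [h3]
  simp only [h1]
  exact tendsto_integral_abs_circleSum.const_mul _

/-! ### The frequency of logarithms of primes -/

theorem isFrequency_logPrimeFrequency : IsFrequency logPrimeFrequency where
  strictMono m n h := by
    have h1 : m.natPred < n.natPred := PNat.natPred_strictMono h
    refine Real.log_lt_log ?_ ?_
    · exact_mod_cast (Nat.prime_nth_prime _).pos
    · exact_mod_cast Nat.nth_strictMono Nat.infinite_setOfPred_prime h1
  nonneg n := Real.log_natCast_nonneg _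
  tendsto_atTop := by
    refine Real.tendsto_log_atTop.comp (tendsto_natCast_atTop_atTop.comp ?_)
    refine (Nat.nth_strictMono Nat.infinite_setOfPred_prime).tendsto_atTop.comp ?_
    exact PNat.natPred_strictMono.monotone.tendsto_atTop_atTop fun b => ⟨b.succPNat, by simp⟩

/-- In the `p j`-adic norm every other prime is a unit, so only the power of `p j` survives and its
exponent must vanish. -/
theorem eq_zero_of_prod_prime_zpow_eq_one {ι : Type*} {s : Finset ι} {p : ι → ℕ}
    (hp : ∀ i, (p i).Prime) (hinj : Function.Injective p) {g : ι → ℤ}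
    (h : ∏ i ∈ s, (p i : ℚ) ^ g i = 1) {j : ι} (hj : j ∈ s) : g j = 0 := by
  have : Fact (p j).Prime := ⟨hp j⟩
  have h1 : ∏ i ∈ s, (p i : ℚ_[p j]) ^ g i = 1 := by
    simpa using congrArg (Rat.cast (K := ℚ_[p j])) h
  have h2 := congrArg norm h1
  rw [norm_prod, norm_one, Finset.prod_eq_single j _ fun h => absurd hj h, Padic.norm_p_zpow] at h2
  · have h3 := (zpow_eq_one_iff_right₀ (Nat.cast_nonneg _)
      (by exact_mod_cast (hp j).one_lt.ne')).1 h2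
    exact neg_eq_zero.1 h3
  · intro i _ hij
    rw [norm_zpow, Padic.norm_natCast_eq_one_iff.2
      ((Nat.coprime_primes (hp j) (hp i)).2 (hinj.ne hij.symm)), one_zpow]

theorem linearIndependent_logPrimeFrequency : LinearIndependent ℚ logPrimeFrequency := by
  -- Integer coefficients let a linear relation between logarithms be exponentiated to a product of
  -- prime powers equal to 1.
  rw [← LinearIndependent.iff_fractionRing ℤ ℚ, linearIndependent_iff']
  intro s g hg n hn
  have hprime : ∀ m : ℕ+, (Nat.nth Nat.Prime m.natPred).Prime := fun m => Nat.prime_nth_prime _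
  have hpos : ∀ m : ℕ+, (0 : ℝ) < (Nat.nth Nat.Prime m.natPred : ℝ) := fun m => by
    exact_mod_cast (hprime m).pos
  refine eq_zero_of_prod_prime_zpow_eq_one hprime
    ((Nat.nth_injective Nat.infinite_setOfPred_prime).comp PNat.natPred_injective) ?_ hn
  have h1 : Real.log (∏ i ∈ s, (Nat.nth Nat.Prime i.natPred : ℝ) ^ g i) = 0 := by
    rw [Real.log_prod fun i _ => (zpow_pos (hpos i) _).ne', ← hg]
    exact Finset.sum_congr rfl fun i _ => by
      rw [Real.log_zpow, logPrimeFrequency, zsmul_eq_mul]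
  have h2 := Real.eq_one_of_pos_of_log_eq_zero (Finset.prod_pos fun i _ => zpow_pos (hpos i) _) h1
  have h3 : ((∏ i ∈ s, (Nat.nth Nat.Prime i.natPred : ℚ) ^ g i : ℚ) : ℝ) = 1 := by
    push_cast
    exact h2
  exact_mod_cast h3

theorem projectionConstant_dirichletSpace {ω : ℕ+ → ℝ} (hω : LinearIndependent ℚ ω)
    (J : Finset ℕ+) : projectionConstant.{0, v} (DirichletSpace ω J) =
      ENNReal.ofReal (torusL1 (Fin J.card)) :=
  projectionConstant_eq_torusL1 ((DirichletSpace.coeffEquiv hω J).trans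
    (LinearIsometryEquiv.piLpCongrLeft 1 ℂ ℂ J.equivFin))

theorem tendsto_projectionConstant_div_sqrt {ω : ℕ+ → ℝ} (hω : LinearIndependent ℚ ω) :
    Tendsto
      (fun x : ℕ+ => (projectionConstant.{0, v} (DirichletSpace ω (Finset.Icc 1 x))).toReal /
        Real.sqrt (x : ℝ)) atTop (𝓝 (Real.sqrt Real.pi / 2)) := by
  have h1 : Tendsto (fun x : ℕ+ => (x : ℕ)) atTop atTop :=
        Monotone.tendsto_atTop_atTop (fun _ _ h => h) fun b => ⟨b.succPNat, by simp⟩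
  refine (tendsto_torusL1_div_sqrt.comp h1).congr fun x => ?_
  have hcard : (Finset.Icc 1 x).card = x := by simp
  rw [projectionConstant_dirichletSpace hω, ENNReal.toReal_ofReal (torusL1_nonneg _), hcard]
  rfl

theorem theorem2p7 :
    (∀ ω : ℕ+ → ℝ, IsFrequency ω → LinearIndependent ℚ ω →
      (∀ J : Finset ℕ+,
        (∃ Φ : DirichletSpace ω J ≃ₗᵢ[ℂ] PiLp 1 (fun _ : J => ℂ),
          ∀ (a : PiLp 1 (fun _ : J => ℂ)) (s : ℂ),
            (Φ.symm a).toFun s = ∑ n : J, a n * Complex.exp (-(ω n : ℂ) * s)) ∧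
        projectionConstant.{0, v} (DirichletSpace ω J) =
          ENNReal.ofReal (torusMean J.card fun z => ‖∑ k, z k‖)) ∧
      Filter.Tendsto
        (fun x : ℕ+ => (projectionConstant.{0, v} (DirichletSpace ω (Finset.Icc 1 x))).toReal /
          Real.sqrt (x : ℝ))
        Filter.atTop (nhds (Real.sqrt Real.pi / 2))) ∧
    IsFrequency logPrimeFrequency ∧ LinearIndependent ℚ logPrimeFrequency ∧
    Filter.Tendsto
      (fun x : ℕ+ =>
        (projectionConstant.{0, v} (DirichletSpace logPrimeFrequency (Finset.Icc 1 x))).toReal /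
          Real.sqrt (x : ℝ))
      Filter.atTop (nhds (Real.sqrt Real.pi / 2)) := by
  refine ⟨fun ω _ hω => ⟨fun J => ⟨⟨DirichletSpace.coeffEquiv hω J,
    DirichletSpace.coeffEquiv_symm_toFun hω⟩, ?_⟩, tendsto_projectionConstant_div_sqrt hω⟩,
    isFrequency_logPrimeFrequency, linearIndependent_logPrimeFrequency,
    tendsto_projectionConstant_div_sqrt linearIndependent_logPrimeFrequency⟩
  rw [projectionConstant_dirichletSpace hω, torusMean_norm_sum]
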